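/- In the Huge Object model the input is an unknown distribution $P$ over $\{0,1\}^n$; an algorithm takes $s$ independent samples from $P$, which form the rows of a matrix $M\in\{0,1\}^{s\times n}$, and may query entries of $M$. A non-adaptive (probabilistic) algorithm with $q$ queries is a probability distribution over pairs consisting of a query set $Q\subseteq\{1,\dots,s\}\times\{1,\dots,n\}$ with $|Q|\le q$ and a decision (accept or reject) that is a function of the answers $M|_Q$. For distributions $P,P'$ over $\{0,1\}^n$ let $d(P,P')=\min_T \mathrm{E}_{(u,v)\sim T}[d_H(u,v)]$ be the earth mover's distance, where $T$ ranges over the couplings of $P$ and $P'$ and $d_H(u,v)$ is the fraction of indices at which $u$ and $v$ differ. Let $\mathcal S_m$ be the property of being supported on at most $m$ strings. An $\varepsilon$-test for $\mathcal S_m$ (with two-sided error) is an algorithm that accepts every $P\in\mathcal S_m$ with probability higher than $\frac23$, and rejects with probability higher than $\frac23$ every $P$ with $\min_{P'\in\mathcal S_m}d(P,P')>\varepsilon$. Theorem. There exist absolute constants $c>0$ and $0<\varepsilon_0<1$ such that for every integer $m\ge 2$, every $0<\varepsilon<\varepsilon_0$, and every sufficiently large $n$ (as a function of $m$ and $\varepsilon$),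 the following holds for all integers $s,q\ge 0$: if there is a non-adaptive $\varepsilon$-test for $\mathcal S_m$ over $\{0,1\}^n$ that uses $s$ samples and makes at most $q$ queries, then $q\ge c\,\varepsilon^{-1}\log\varepsilon^{-1}$. -/

import Mathlib

open scoped ENNReal

namespace HugeObject

/-- The set `{0,1}^n` of binary strings of length `n`. -/
abbrev BitString (n : ℕ) : Type := Fin n → Bool

/-! ### Distances and properties -/

/-- The normalized Hamming distance between two strings. -/
noncomputable def stringDist {n : ℕ} (u v : BitString n) : ℝ≥0∞ :=
  (hammingDist u v : ℝ≥0∞) / (n : ℝ≥0∞)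

/-- `T` is a transfer distribution (a coupling) from `P` to `Q`. -/
def IsTransfer {α β : Type} (P : PMF α) (Q : PMF β) (T : PMF (α × β)) : Prop :=
  T.map Prod.fst = P ∧ T.map Prod.snd = Q

/-- The earth mover's distance between two distributions over `{0,1}^n`: the infimum, over the
transfer distributions `T` from `P` to `Q`, of the expected distance of a pair drawn from `T`. -/
noncomputable def emd {n : ℕ} (P Q : PMF (BitString n)) : ℝ≥0∞ :=
  ⨅ (T : PMF (BitString n × BitString n)) (_ : IsTransfer P Q T),
    ∑ p : BitString n × BitString n, T p * stringDist p.1 p.2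

/-- The earth mover's distance of a distribution from a property of distributions. -/
noncomputable def distToProperty {n : ℕ} (P : PMF (BitString n))
    (𝒮 : Set (PMF (BitString n))) : ℝ≥0∞ :=
  ⨅ Q ∈ 𝒮, emd P Q

/-- `P` is `ε`-far from `𝒮`: its distance from `𝒮` is more than `ε`. -/
def IsFar {n : ℕ} (ε : ℝ) (P : PMF (BitString n)) (𝒮 : Set (PMF (BitString n))) : Prop :=
  ENNReal.ofReal ε < distToProperty P 𝒮

/-- The property `S_m` (at string length `n`) of being supported by at most `m` strings. -/
def boundedSupport (n m : ℕ) : Set (PMF (BitString n)) :=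
  {P | P.support.ncard ≤ m}

/-! ### Non-adaptive algorithms -/

/-- The distribution of the `s × n` matrix whose rows are `s` independent samples from `P`. -/
noncomputable def sampleMatrix {n : ℕ} (P : PMF (BitString n)) (s : ℕ) :
    PMF (Fin s → BitString n) :=
  PMF.ofFintype (fun M => ∏ i, P (M i)) (by
    have hP : ∑ x, P x = 1 := by simpa [tsum_fintype] using P.tsum_coe
    rw [← Fintype.piFinset_univ, Finset.sum_prod_piFinset Finset.univ (fun _ x => P x)]
    simp [hP])

/-- A deterministic non-adaptive algorithm over `s` samples of length-`n` strings: a set of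
queries `(i, j)` (bit `j` of sample `i`), and a decision (`true` means accept) as a function of
the vector of answers. -/
structure DetAlg (n s : ℕ) where
  queries : Finset (Fin s × Fin n)
  decision : ({e : Fin s × Fin n // e ∈ queries} → Bool) → Bool

/-- The output of a deterministic non-adaptive algorithm when the samples are the rows of `M`. -/
def DetAlg.run {n s : ℕ} (T : DetAlg n s) (M : Fin s → BitString n) : Bool :=
  T.decision fun e => M e.1.1 e.1.2

/-- A probabilistic non-adaptive algorithm over `s` samples of length-`n` strings: a distribution
over the deterministic ones. -/
abbrev NonAdaptiveAlg (n s : ℕ) : Type := PMF (DetAlg n s)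

/-- The distribution of the output of `𝒜` on the input distribution `P`: the internal randomness
of `𝒜` and the samples are independent. -/
noncomputable def NonAdaptiveAlg.output {n s : ℕ} (𝒜 : NonAdaptiveAlg n s)
    (P : PMF (BitString n)) : PMF Bool :=
  PMF.bind 𝒜 fun T => (sampleMatrix P s).map T.run

/-- `𝒜` never makes more than `q` queries. -/
def NonAdaptiveAlg.MakesAtMost {n s : ℕ} (𝒜 : NonAdaptiveAlg n s) (q : ℕ) : Prop :=
  ∀ T ∈ PMF.support 𝒜, T.queries.card ≤ q

/-- `𝒜` is a (two-sided error) `ε`-test for `𝒮`: it accepts every distribution in `𝒮`, and rejects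
every distribution that is `ε`-far from `𝒮`, with probability higher than `2/3`. -/
def NonAdaptiveAlg.IsTest {n s : ℕ} (𝒜 : NonAdaptiveAlg n s) (ε : ℝ)
    (𝒮 : Set (PMF (BitString n))) : Prop :=
  (∀ P ∈ 𝒮, 2 / 3 < 𝒜.output P true) ∧
  (∀ P : PMF (BitString n), IsFar ε P 𝒮 → 2 / 3 < 𝒜.output P false)

end HugeObject

/-!
Write `h = m / 2`, and fix a code of `h` strings of length `n`, any two of which differ in at least a
quarter of the positions. For each scale `k` let `D` be a random set of about `n / (32 · 2 ^ k)`
positions, cut into two halves `C` and `E`. Every codeword is replaced by the block of its four flips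
on `∅`, `C ∪ E`, `C`, `E`. In the distribution `blockDist` the block is uniform, the first two members
of a block together have probability `1 - p`, and the last two together have probability `p`, for
`p = 1024 · 2 ^ k · ε`.

For `p = 0` the support has `2 h ≤ m` elements (`blockDist_zero_mem`). Otherwise it consists of `4 h`
strings that are pairwise at distance at least `|C| / n`, and at least `h` of them are far from all
the strings of a given support of size `m ≤ 2 h + 1`; hence the distance from `boundedSupport n m` is
more than `ε` (`le_distToProperty`, `isFar_blockDist`).

A row that is queried at most once inside `D` has the same law in both cases
(`sum_blockDist_mul_eq`), and the two laws of any row differ by at most `p`. Replacing the rows one by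
one (`sum_prod_mul_le`) shows that a test has to see `1 / (3 p)` rows in expectation that are queried
at least twice in `D`. A row with `r` queries is of this kind with probability at most
`min 1 (r² / 4 ^ k)` (`card_filter_two_le_inter`), which gives a contribution of at most
`1024 ε · min (2 ^ k) (r² / 2 ^ k)` at scale `k` (`third_le_scale`). The sum of these minima over all
the scales is at most `6 r` (`sum_min_two_pow_le`), since a row can be efficient only at the scales
with `2 ^ k` near `r`. So the total number of queries is at least of the order of `ε⁻¹` times the
number of scales, which is of the order of `log ε⁻¹`.
-/

namespace HugeObject

/-! ### Combinatorial preliminaries -/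

/-- Over all the scales `k`, rows with `r` queries are useful only near `2 ^ k = r`. -/
lemma sum_min_two_pow_le (r : ℝ) (hr : 0 ≤ r) (K : ℕ) :
    ∑ k ∈ Finset.range K, min ((2 : ℝ) ^ k) (r ^ 2 / 2 ^ k) ≤ 6 * r := by
  rcases hr.eq_or_lt with rfl | hr
  · have : ∀ k ∈ Finset.range K, min ((2 : ℝ) ^ k) ((0 : ℝ) ^ 2 / 2 ^ k) ≤ 0 := fun k _ => by simp
    exact (Finset.sum_nonpos this).trans_eq (by simp)
  -- Each summand is at most the increment of the bounded potential `6 r · 2 ^ k / (2 ^ k + r)`.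
  set φ : ℕ → ℝ := fun k => 6 * r * (2 ^ k / (2 ^ k + r)) with hφ
  have step : ∀ k ∈ Finset.range K,
      min ((2 : ℝ) ^ k) (r ^ 2 / 2 ^ k) ≤ φ (k + 1) - φ k := by
    intro k _
    simp only [hφ, pow_succ]
    have hx : (0 : ℝ) < 2 ^ k := by positivity
    generalize (2 : ℝ) ^ k = x at hx
    have e : 6 * r * (x * 2 / (x * 2 + r)) - 6 * r * (x / (x + r))
        = 6 * x * r ^ 2 / ((x * 2 + r) * (x + r)) := by
      field_simp; ring
    rw [e]
    rcases le_total x r with h | h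
    · refine (min_le_left _ _).trans ?_
      rw [le_div_iff₀ (by positivity)]
      have : (x * 2 + r) * (x + r) ≤ 6 * r ^ 2 := by nlinarith
      nlinarith
    · refine (min_le_right _ _).trans ?_
      rw [div_le_div_iff₀ hx (by positivity)]
      have : (x * 2 + r) * (x + r) ≤ 6 * x ^ 2 := by nlinarith
      nlinarith [sq_nonneg r]
  refine (Finset.sum_le_sum step).trans ?_
  rw [Finset.sum_range_sub]
  have h1 : φ K ≤ 6 * r := by
    have : (2 : ℝ) ^ K / (2 ^ K + r) ≤ 1 := by
      rw [div_le_one (by positivity)]; linarith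
    simp only [hφ]; nlinarith
  have h0 : 0 ≤ φ 0 := by simp only [hφ]; positivity
  linarith

/-- A random set of `d` among `n` positions contains two given positions with probability at most
`(d / n)²`. -/
lemma card_filter_pair_subset_le {n d : ℕ} {i j : Fin n} (hij : i ≠ j) :
    n ^ 2 * ((Finset.univ.powersetCard d).filter
        fun D : Finset (Fin n) => i ∈ D ∧ j ∈ D).card
      ≤ d ^ 2 * n.choose d := by
  have hn : 2 ≤ n := by
    have := i.2; have := j.2; have : i.1 ≠ j.1 := fun h => hij (Fin.ext h); omega
  set S := (Finset.univ.powersetCard d).filter fun D : Finset (Fin n) => i ∈ D ∧ j ∈ D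
  rcases Nat.lt_or_ge d 2 with hd | hd
  · have : S = ∅ := by
      refine Finset.filter_eq_empty_iff.2 fun D hD h => ?_
      have h2 : ({i, j} : Finset (Fin n)).card ≤ D.card :=
        Finset.card_le_card (by simp [Finset.insert_subset_iff, h.1, h.2])
      rw [Finset.card_pair hij, (Finset.mem_powersetCard.1 hD).2] at h2
      omega
    simp [this]
  obtain ⟨a, rfl⟩ := Nat.exists_eq_add_of_le' hn
  obtain ⟨b, rfl⟩ := Nat.exists_eq_add_of_le' hd
  have hS : S.card ≤ a.choose b := by
    have h : S.card ≤ (Finset.powersetCard b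
        ((Finset.univ : Finset (Fin (a + 2))) \ {i, j})).card := by
      refine Finset.card_le_card_of_injOn (fun D => D \ {i, j}) ?_ ?_
      · intro D hD
        obtain ⟨h1, h2⟩ := Finset.mem_filter.1 (Finset.mem_coe.1 hD)
        have h2' : ({i, j} : Finset (Fin (a + 2))) ⊆ D := by
          simp [Finset.insert_subset_iff, h2.1, h2.2]
        refine Finset.mem_coe.2 (Finset.mem_powersetCard.2
          ⟨Finset.sdiff_subset_sdiff (Finset.subset_univ _) le_rfl, ?_⟩)
        rw [Finset.card_sdiff_of_subset h2', (Finset.mem_powersetCard.1 h1).2,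
          Finset.card_pair hij]; rfl
      · intro D hD D' hD' h
        obtain ⟨-, h2⟩ := Finset.mem_filter.1 (Finset.mem_coe.1 hD)
        obtain ⟨-, h3⟩ := Finset.mem_filter.1 (Finset.mem_coe.1 hD')
        have e1 : ({i, j} : Finset (Fin (a + 2))) ⊆ D := by
          simp [Finset.insert_subset_iff, h2.1, h2.2]
        have e2 : ({i, j} : Finset (Fin (a + 2))) ⊆ D' := by
          simp [Finset.insert_subset_iff, h3.1, h3.2]
        have h : D \ {i, j} = D' \ {i, j} := h
        rw [← Finset.sdiff_union_of_subset e1, h, Finset.sdiff_union_of_subset e2]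
    rwa [Finset.card_powersetCard, Finset.card_sdiff_of_subset (Finset.subset_univ _),
      Finset.card_pair hij, Finset.card_univ, Fintype.card_fin] at h
  rcases Nat.lt_or_ge a b with hab | hab
  · rw [Nat.choose_eq_zero_of_lt hab] at hS
    simp [Nat.le_zero.1 hS]
  have e1 := Nat.add_one_mul_choose_eq a b
  have e2 := Nat.add_one_mul_choose_eq (a + 1) (b + 1)
  have e3 : (a + 2) * (a + 1) * a.choose b = (b + 2) * (b + 1) * (a + 2).choose (b + 2) := by
    calc (a + 2) * (a + 1) * a.choose b = (a + 2) * ((a + 1) * a.choose b) := by ring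
      _ = (b + 1) * ((a + 2) * (a + 1).choose (b + 1)) := by rw [e1]; ring
      _ = _ := by
        have : (a + 2) * (a + 1).choose (b + 1) = (a + 2).choose (b + 2) * (b + 2) := e2
        rw [this]; ring
  refine (Nat.mul_le_mul_left _ hS).trans ?_
  -- `(a+2)²·(b+1) ≤ (b+2)·(a+2)(a+1)`, that is, `(b+1)/(b+2) ≤ (a+1)/(a+2)`.
  have e4 : (a + 2) * (b + 1) ≤ (b + 2) * (a + 1) := by nlinarith
  refine Nat.le_of_mul_le_mul_right (c := b + 1) ?_ (Nat.succ_pos _)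
  calc (a + 2) ^ 2 * a.choose b * (b + 1)
      = ((a + 2) * (b + 1)) * ((a + 2) * a.choose b) := by ring
    _ ≤ ((b + 2) * (a + 1)) * ((a + 2) * a.choose b) := Nat.mul_le_mul_right _ e4
    _ = (b + 2) * ((a + 2) * (a + 1) * a.choose b) := by ring
    _ = (b + 2) ^ 2 * (a + 2).choose (b + 2) * (b + 1) := by rw [e3]; ring

/-- Union bound over the pairs of positions in `R`. -/
lemma card_filter_two_le_inter {n d : ℕ} (R : Finset (Fin n)) :
    n ^ 2 * ((Finset.univ.powersetCard d).filter
        fun D : Finset (Fin n) => 2 ≤ (R ∩ D).card).card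
      ≤ R.card ^ 2 * (d ^ 2 * n.choose d) := by
  have hsub : (Finset.univ.powersetCard d).filter
        (fun D : Finset (Fin n) => 2 ≤ (R ∩ D).card) ⊆
      R.offDiag.biUnion fun e => (Finset.univ.powersetCard d).filter
        fun D : Finset (Fin n) => e.1 ∈ D ∧ e.2 ∈ D := by
    intro D hD
    obtain ⟨h1, h2⟩ := Finset.mem_filter.1 hD
    obtain ⟨i, hi, j, hj, hij⟩ := Finset.one_lt_card.1 (show 1 < (R ∩ D).card from h2)
    rw [Finset.mem_inter] at hi hj
    exact Finset.mem_biUnion.2 ⟨(i, j), Finset.mem_offDiag.2 ⟨hi.1, hj.1, hij⟩,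
      Finset.mem_filter.2 ⟨h1, hi.2, hj.2⟩⟩
  calc _ ≤ n ^ 2 * ∑ e ∈ R.offDiag, _ :=
        Nat.mul_le_mul_left _ ((Finset.card_le_card hsub).trans Finset.card_biUnion_le)
    _ = ∑ e ∈ R.offDiag, n ^ 2 * _ := Finset.mul_sum _ _ _
    _ ≤ ∑ e ∈ R.offDiag, d ^ 2 * n.choose d :=
        Finset.sum_le_sum fun e he => card_filter_pair_subset_le (Finset.mem_offDiag.1 he).2.2
    _ = R.offDiag.card * (d ^ 2 * n.choose d) := by simp
    _ ≤ _ := by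
        refine Nat.mul_le_mul_right _ ?_
        rw [Finset.offDiag_card, sq]; exact Nat.sub_le _ _

/-- A Hadamard-type code: the columns of the `n × h` table whose rows run repeatedly through all
the strings of length `h`. -/
lemma exists_code (h n : ℕ) (hn : 2 ^ h ≤ n) :
    ∃ x : Fin h → BitString n, ∀ t t', t ≠ t' → n ≤ 4 * hammingDist (x t) (x t') := by
  let e : Fin (2 ^ h) ≃ (Fin h → Bool) :=
    (finCongr (by simp)).trans (Fintype.equivFin (Fin h → Bool)).symm
  have hpos : 0 < 2 ^ h := by positivity
  refine ⟨fun t j => e ⟨j.1 % 2 ^ h, Nat.mod_lt _ hpos⟩ t, fun t t' htt => ?_⟩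
  set A : Finset (Fin h → Bool) := Finset.univ.filter fun b => b t ≠ b t'
  have hA : 2 ^ h ≤ 2 * A.card := by
    have h1 : A.card + (Finset.univ.filter fun b : Fin h → Bool => ¬ b t ≠ b t').card = 2 ^ h := by
      rw [Finset.card_filter_add_card_filter_not]; simp
    -- Flipping the bit `t` maps the strings with `b t = b t'` injectively to the others.
    have h2 : (Finset.univ.filter fun b : Fin h → Bool => ¬ b t ≠ b t').card ≤ A.card := by
      refine Finset.card_le_card_of_injOn (fun b => Function.update b t (!(b t))) ?_ ?_
      · intro b hb
        simp only [ne_eq, not_not, Finset.coe_filter, Finset.mem_univ, true_and,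
          Set.mem_ofPred_eq] at hb
        simp [A, Function.update_of_ne htt.symm, hb]
      · intro b _ b' _ hbb
        funext i
        have := congrFun hbb i
        by_cases hi : i = t
        · subst hi; simpa using this
        · simpa [Function.update_of_ne hi] using this
    omega
  -- Each of the `n / 2 ^ h` complete runs contributes one position for every element of `A`.
  have hw : n / 2 ^ h * A.card ≤ hammingDist
      (fun j : Fin n => e ⟨j.1 % 2 ^ h, Nat.mod_lt _ hpos⟩ t)
      (fun j : Fin n => e ⟨j.1 % 2 ^ h, Nat.mod_lt _ hpos⟩ t') := by
    have hlt : ∀ (a : Fin (n / 2 ^ h)) (b : Fin (2 ^ h)), a.1 * 2 ^ h + b.1 < n := by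
      intro a b
      calc a.1 * 2 ^ h + b.1 < (a.1 + 1) * 2 ^ h := by have := b.2; linarith
        _ ≤ n / 2 ^ h * 2 ^ h := Nat.mul_le_mul_right _ a.2
        _ ≤ n := Nat.div_mul_le_self _ _
    have hmod : ∀ (a : ℕ) (b : Fin (2 ^ h)), (a * 2 ^ h + b.1) % 2 ^ h = b.1 := fun a b => by
      rw [Nat.mul_add_mod_self_right, Nat.mod_eq_of_lt b.2]
    have := Finset.card_le_card_of_injOn
      (s := (Finset.univ : Finset (Fin (n / 2 ^ h))) ×ˢ A)
      (t := Finset.univ.filter fun j : Fin n =>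
        e ⟨j.1 % 2 ^ h, Nat.mod_lt _ hpos⟩ t ≠ e ⟨j.1 % 2 ^ h, Nat.mod_lt _ hpos⟩ t')
      (fun ab => ⟨ab.1.1 * 2 ^ h + (e.symm ab.2).1, hlt _ _⟩) ?_ ?_
    · simpa [hammingDist] using this
    · rintro ⟨a, b⟩ hab
      have hb : b t ≠ b t' := by simpa [A] using hab
      simpa [hmod] using hb
    · rintro ⟨a, b⟩ - ⟨a', b'⟩ - hab
      have hab : a.1 * 2 ^ h + (e.symm b).1 = a'.1 * 2 ^ h + (e.symm b').1 :=
        congrArg Fin.val hab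
      have h1 : (e.symm b).1 = (e.symm b').1 := by
        have := congrArg (· % 2 ^ h) hab
        simpa only [hmod] using this
      have h2 : a.1 = a'.1 := by
        rw [h1] at hab; exact Nat.eq_of_mul_eq_mul_right hpos (Nat.add_right_cancel hab)
      exact Prod.ext (Fin.ext h2) (e.symm.injective (Fin.ext h1))
  have hd : n < 2 ^ h * (n / 2 ^ h + 1) := Nat.lt_mul_div_succ n hpos
  have h1 : 1 ≤ n / 2 ^ h := (Nat.one_le_div_iff hpos).2 hn
  refine le_trans ?_ (Nat.mul_le_mul_left 4 hw)
  nlinarith [Nat.mul_le_mul_left (n / 2 ^ h) hA]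

/-! ### The hard distributions -/

/-- The string `x`, flipped on `C` if the first bit of `b` is set, and on `E` if the second one
is. Used for disjoint `C` and `E`. -/
def flipOn {n : ℕ} (C E : Finset (Fin n)) (x : BitString n) (b : Bool × Bool) : BitString n :=
  fun j => x j ^^ (if j ∈ C then b.1 else if j ∈ E then b.2 else false)

lemma le_hammingDist_flipOn {n l : ℕ} {C E : Finset (Fin n)} (hCE : Disjoint C E)
    (hC : l ≤ C.card) (hE : l ≤ E.card) (x : BitString n) {b b' : Bool × Bool} (hb : b ≠ b') :
    l ≤ hammingDist (flipOn C E x b) (flipOn C E x b') := by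
  by_cases h1 : b.1 = b'.1
  · have h2 : b.2 ≠ b'.2 := fun h => hb (Prod.ext h1 h)
    refine hE.trans (Finset.card_le_card fun j hj => ?_)
    have hjC : j ∉ C := fun h => Finset.disjoint_left.1 hCE h hj
    simpa [flipOn, hj, hjC] using h2
  · refine hC.trans (Finset.card_le_card fun j hj => ?_)
    simpa [flipOn, hj] using h1

lemma hammingDist_le_hammingDist_flipOn_add {n : ℕ} (C E : Finset (Fin n)) (x x' : BitString n)
    (b b' : Bool × Bool) :
    hammingDist x x' ≤ hammingDist (flipOn C E x b) (flipOn C E x' b') + (C ∪ E).card := by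
  refine le_trans (Finset.card_le_card fun j hj => ?_) (Finset.card_union_le _ _)
  by_cases hD : j ∈ C ∪ E
  · exact Finset.mem_union_right _ hD
  · refine Finset.mem_union_left _ ?_
    rw [Finset.mem_union, not_or] at hD
    simpa [flipOn, hD.1, hD.2] using hj

/-- The distribution of an index `(t, b)`: the block `t` and each bit of `b` are uniform, the two
bits of `b` differ with probability `p`, and `t` is independent of `b`. -/
noncomputable def blockIndex (h : ℕ) [NeZero h] (p : ℝ≥0∞) (hp : p ≤ 1) :
    PMF (Fin h × Bool × Bool) :=
  PMF.ofFintype (fun i => (if i.2.1 = i.2.2 then 1 - p else p) / (2 * h)) (by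
    have h0 : (2 * h : ℝ≥0∞) ≠ 0 := by simp [NeZero.ne h]
    have e : (1 - p + p + (p + (1 - p))) = 2 := by
      rw [add_comm p, tsub_add_cancel_of_le hp, one_add_one_eq_two]
    simp only [Fintype.sum_prod_type, Fintype.sum_bool, ← ENNReal.div_add_div_same.symm]
    simp only [if_true, reduceCtorEq, if_false, e, Finset.sum_const,
      Finset.card_univ, Fintype.card_fin, nsmul_eq_mul]
    rw [← mul_div_assoc, mul_comm, ENNReal.div_self h0 (by finiteness)])

/-- The hard distribution: every block consists of a codeword `x t` and its flips on `C`, on `E`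
and on `C ∪ E`; the flips on exactly one of `C` and `E` together have probability `p`. -/
noncomputable def blockDist {n h : ℕ} [NeZero h] (x : Fin h → BitString n) (C E : Finset (Fin n))
    (p : ℝ≥0∞) (hp : p ≤ 1) : PMF (BitString n) :=
  (blockIndex h p hp).map fun i => flipOn C E (x i.1) i.2

lemma sum_map_mul {α β : Type*} [Fintype α] [Fintype β] (P : PMF α) (g : α → β)
    (F : β → ℝ≥0∞) : ∑ z, (P.map g) z * F z = ∑ i, P i * F (g i) := by
  classical
  simp only [PMF.map_apply, tsum_fintype, Finset.sum_mul]
  rw [Finset.sum_comm]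
  simp [ite_mul]

lemma map_apply_injective {α β : Type*} (P : PMF α) {g : α → β} (hg : g.Injective) (i : α) :
    (P.map g) (g i) = P i := by
  classical
  rw [PMF.map_apply, tsum_eq_single i (fun j hj => if_neg fun e => hj (hg e.symm)), if_pos rfl]

lemma map_fst_apply {α β : Type*} [Fintype α] [Fintype β] (T : PMF (α × β)) (u : α) :
    (T.map Prod.fst) u = ∑ v, T (u, v) := by
  classical
  rw [PMF.map_apply, tsum_fintype, Fintype.sum_prod_type, Finset.sum_comm]
  simp

lemma blockDist_zero_mem {n h m : ℕ} [NeZero h] (x : Fin h → BitString n) (C E : Finset (Fin n))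
    (hm : 2 * h ≤ m) : blockDist x C E 0 zero_le_one ∈ boundedSupport n m := by
  have hsub : (blockDist x C E 0 zero_le_one).support ⊆
      Set.range fun i : Fin h × Bool => flipOn C E (x i.1) (i.2, i.2) := by
    intro z hz
    rw [blockDist, PMF.support_map] at hz
    obtain ⟨⟨t, b, b'⟩, hi, rfl⟩ := hz
    have : b = b' := by
      by_contra hne
      exact hi (by simp [blockIndex, hne])
    exact ⟨(t, b), by simp [this]⟩
  refine (Set.ncard_le_ncard hsub (Set.toFinite _)).trans (le_trans ?_ hm)
  rw [← Set.image_univ]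
  refine (Set.ncard_image_le).trans ?_
  simp [Set.ncard_univ, mul_comm]

lemma le_blockIndex {h : ℕ} [NeZero h] {p : ℝ≥0∞} (hp : p ≤ 1) (hp2 : p ≤ 1 - p)
    (i : Fin h × Bool × Bool) : p / (2 * h) ≤ blockIndex h p hp i := by
  rw [blockIndex, PMF.ofFintype_apply]
  refine ENNReal.div_le_div_right ?_ _
  split_ifs
  exacts [hp2, le_rfl]

/-- Passing from `0` to `p` lowers the probability of any event by at most `p`. -/
lemma blockDist_zero_le {n h : ℕ} [NeZero h] (x : Fin h → BitString n) (C E : Finset (Fin n))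
    {p : ℝ≥0∞} (hp : p ≤ 1) (z : BitString n) :
    blockDist x C E 0 zero_le_one z ≤
      blockDist x C E p hp z + p * blockDist x C E 0 zero_le_one z := by
  classical
  simp only [blockDist, PMF.map_apply, tsum_fintype, Finset.mul_sum, ← Finset.sum_add_distrib]
  refine Finset.sum_le_sum fun i _ => ?_
  split_ifs with hz
  · simp only [blockIndex, PMF.ofFintype_apply]
    split_ifs with hb
    · rw [← mul_div_assoc, ENNReal.div_add_div_same]
      refine ENNReal.div_le_div_right ?_ _
      simp [tsub_add_cancel_of_le hp]
    · simp
  · simp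

/-- A row that is read in at most one position of `C ∪ E` has the same law whatever `p` is: the
only bit of `b` that it may reveal is uniform. -/
lemma sum_blockDist_mul_eq {n h : ℕ} [NeZero h] (x : Fin h → BitString n) {C E : Finset (Fin n)}
    {p : ℝ≥0∞} (hp : p ≤ 1) (hCE : Disjoint C E) (R : Finset (Fin n))
    (hR : (R ∩ (C ∪ E)).card ≤ 1) (F : BitString n → ℝ≥0∞)
    (hF : ∀ z z', (∀ j ∈ R, z j = z' j) → F z = F z') :
    ∑ z, blockDist x C E p hp z * F z = ∑ t, (2 * h : ℝ≥0∞)⁻¹ *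
      (F (flipOn C E (x t) (true, true)) + F (flipOn C E (x t) (false, false))) := by
  rw [blockDist, sum_map_mul, Fintype.sum_prod_type]
  refine Finset.sum_congr rfl fun t _ => ?_
  have hw : (1 - p) / (2 * h) + p / (2 * h) = (2 * h : ℝ≥0∞)⁻¹ := by
    rw [ENNReal.div_add_div_same, tsub_add_cancel_of_le hp, one_div]
  simp only [Fintype.sum_prod_type, Fintype.sum_bool, blockIndex, PMF.ofFintype_apply, if_true,
    reduceCtorEq, if_false]
  rw [← hw]
  have key : (∀ j ∈ R, j ∉ E) ∨ (∀ j ∈ R, j ∉ C) := by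
    by_contra! hcon
    obtain ⟨⟨i, hi, hiE⟩, j, hj, hjC⟩ := hcon
    have : i = j := Finset.card_le_one.1 hR i (by simp [hi, hiE]) j (by simp [hj, hjC])
    exact Finset.disjoint_left.1 hCE hjC (this ▸ hiE)
  rcases key with hk | hk
  · have hc : ∀ c e e', F (flipOn C E (x t) (c, e)) = F (flipOn C E (x t) (c, e')) :=
      fun c e e' => hF _ _ fun j hj => by simp [flipOn, hk j hj]
    rw [hc true false true, hc false true false]
    ring
  · have hc : ∀ c c' e, F (flipOn C E (x t) (c, e)) = F (flipOn C E (x t) (c', e)) :=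
      fun c c' e => hF _ _ fun j hj => by simp [flipOn, hk j hj]
    rw [hc true false false, hc false true true]
    ring

/-! ### Distance from bounded support -/

/-- If a distribution gives weight at least `θ` to each of the strings `y i`, which are pairwise
at distance at least `l / n`, then its distance from `boundedSupport n m` is at least `l / (2n)`
times `θ` times any lower bound on the number of strings `y i` in excess of `m`: a string of the
support of the other distribution is within `l / (2n)` of at most one `y i`. -/
lemma le_distToProperty {ι : Type*} [Fintype ι] {n m l N : ℕ} (P : PMF (BitString n))
    (y : ι → BitString n) (hy : ∀ i j, i ≠ j → l ≤ hammingDist (y i) (y j)) (hl : 0 < l)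
    {θ : ℝ≥0∞} (hθ : ∀ i, θ ≤ P (y i)) (hN : N + m ≤ Fintype.card ι) :
    (l / (2 * n) : ℝ≥0∞) * (N * θ) ≤ distToProperty P (boundedSupport n m) := by
  classical
  have hinj : y.Injective := fun i j hij => by
    by_contra hne
    have := hy i j hne
    rw [hij, hammingDist_self] at this
    omega
  refine le_iInf₂ fun Q hQ => le_iInf₂ fun T hT => ?_
  -- The indices `i` whose `y i` is close to the support of `Q`.
  set near : Finset ι := Finset.univ.filter fun i => ∃ z ∈ Q.support, 2 * hammingDist (y i) z < l
  have hnear : near.card ≤ m := by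
    refine le_trans ?_ (show Q.support.ncard ≤ m from hQ)
    rw [Set.ncard_eq_toFinset_card']
    have hch : ∀ i ∈ near, ∃ z ∈ Q.support, 2 * hammingDist (y i) z < l :=
      fun i hi => (Finset.mem_filter.1 hi).2
    choose! f hf1 hf2 using hch
    refine Finset.card_le_card_of_injOn f (fun i hi => by simpa using hf1 i hi) ?_
    intro i hi j hj hij
    by_contra hne
    have h1 := hf2 i hi
    have h2 := hf2 j hj
    rw [← hij, hammingDist_comm] at h2
    have := hy i j hne
    have := hammingDist_triangle (y i) (f i) (y j)
    omega
  have hfar : N ≤ nearᶜ.card := by rw [Finset.card_compl]; omega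
  have hTP : ∀ u, ∑ v, T (u, v) = P u := by
    intro u
    rw [← hT.1, map_fst_apply]
  have hdist : ∀ i ∈ nearᶜ, ∀ v, T (y i, v) * (l / (2 * n)) ≤ T (y i, v) * stringDist (y i) v := by
    intro i hi v
    by_cases hv : T (y i, v) = 0
    · simp [hv]
    have hvQ : v ∈ Q.support := by
      rw [← hT.2, PMF.support_map]
      exact ⟨(y i, v), hv, rfl⟩
    have h1 : l ≤ 2 * hammingDist (y i) v := by
      by_contra! hlt
      exact Finset.mem_compl.1 hi (Finset.mem_filter.2 ⟨Finset.mem_univ _, v, hvQ, hlt⟩)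
    gcongr
    rw [stringDist, ← ENNReal.mul_div_mul_left (hammingDist (y i) v : ℝ≥0∞) n two_ne_zero
      (by finiteness)]
    gcongr
    exact_mod_cast h1
  calc (l / (2 * n) : ℝ≥0∞) * (N * θ) ≤ (l / (2 * n)) * ∑ i ∈ nearᶜ, P (y i) := by
        gcongr
        calc (N : ℝ≥0∞) * θ ≤ nearᶜ.card * θ := by gcongr
          _ = ∑ i ∈ nearᶜ, θ := by simp
          _ ≤ _ := Finset.sum_le_sum fun i _ => hθ i
    _ = ∑ i ∈ nearᶜ, ∑ v, T (y i, v) * (l / (2 * n)) := by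
        rw [mul_comm, Finset.sum_mul]
        exact Finset.sum_congr rfl fun i _ => by rw [← hTP, Finset.sum_mul]
    _ ≤ ∑ i ∈ nearᶜ, ∑ v, T (y i, v) * stringDist (y i) v :=
        Finset.sum_le_sum fun i hi => Finset.sum_le_sum fun v _ => hdist i hi v
    _ = ∑ u ∈ nearᶜ.image y, ∑ v, T (u, v) * stringDist u v :=
        (Finset.sum_image (f := fun u => ∑ v, T (u, v) * stringDist u v)
          fun _ _ _ _ h => hinj h).symm
    _ ≤ ∑ u, ∑ v, T (u, v) * stringDist u v :=
        Finset.sum_le_univ_sum_of_nonneg fun _ => zero_le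
    _ = ∑ p : BitString n × BitString n, T p * stringDist p.1 p.2 := by rw [Fintype.sum_prod_type]

/-! ### Replacing the rows one by one -/

lemma sum_fin_succ_pi {α : Type*} [Fintype α] {s : ℕ} (G : (Fin (s + 1) → α) → ℝ≥0∞) :
    ∑ M, G M = ∑ x, ∑ M : Fin s → α, G (Fin.cons x M) := by
  rw [← Fintype.sum_prod_type' fun x M => G (Fin.cons x M)]
  exact (Fintype.sum_equiv (Fin.consEquiv fun _ => α) _ _ fun _ => rfl).symm

/-- Hybrid argument: if replacing the law `μ` of a single row `i` by `ν` lowers the expectation of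
`f` by at most `c i`, whatever the other rows are, then replacing all the laws lowers it by at most
the sum of the `c i`. -/
lemma sum_prod_mul_le {α : Type*} [Fintype α] (μ ν : PMF α) : ∀ {s : ℕ}
    (f : (Fin s → α) → ℝ≥0∞) (c : Fin s → ℝ≥0∞),
    (∀ i M, ∑ x, μ x * f (Function.update M i x) ≤ ∑ x, ν x * f (Function.update M i x) + c i) →
    ∑ M, (∏ i, μ (M i)) * f M ≤ ∑ M, (∏ i, ν (M i)) * f M + ∑ i, c i
  | 0, f, c, _ => by simp
  | s + 1, f, c, H => by
    have hone : ∀ P : PMF α, ∑ x, P x = 1 := fun P => by simpa [tsum_fintype] using P.tsum_coe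
    have hprod : ∑ M : Fin s → α, ∏ i, ν (M i) = 1 := by
      rw [← Fintype.piFinset_univ, Finset.sum_prod_piFinset Finset.univ (fun _ x => ν x)]
      simp [hone]
    have ih : ∀ x, ∑ M : Fin s → α, (∏ i, μ (M i)) * f (Fin.cons x M) ≤
        ∑ M : Fin s → α, (∏ i, ν (M i)) * f (Fin.cons x M) + ∑ i : Fin s, c i.succ := fun x =>
      sum_prod_mul_le μ ν (fun M => f (Fin.cons x M)) (fun i => c i.succ) fun i M => by
        simpa only [Fin.cons_update] using H i.succ (Fin.cons x M)
    have h0 : ∀ M : Fin s → α, ∑ x, μ x * f (Fin.cons x M) ≤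
        ∑ x, ν x * f (Fin.cons x M) + c 0 := fun M => by
      obtain ⟨x₀⟩ : Nonempty α := ⟨μ.support_nonempty.some⟩
      simpa only [Fin.update_cons_zero] using H 0 (Fin.cons x₀ M)
    simp only [sum_fin_succ_pi, Fin.prod_univ_succ, Fin.cons_zero, Fin.cons_succ, Fin.sum_univ_succ,
      mul_assoc, ← Finset.mul_sum]
    calc ∑ x, μ x * ∑ M : Fin s → α, (∏ i, μ (M i)) * f (Fin.cons x M)
        ≤ ∑ x, μ x * (∑ M : Fin s → α, (∏ i, ν (M i)) * f (Fin.cons x M)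
            + ∑ i : Fin s, c i.succ) := by gcongr with x; exact ih x
      _ = ∑ M : Fin s → α, (∏ i, ν (M i)) * ∑ x, μ x * f (Fin.cons x M)
            + ∑ i : Fin s, c i.succ := by
          simp only [mul_add, Finset.sum_add_distrib, ← Finset.sum_mul, hone, one_mul,
            Finset.mul_sum (ι := Fin s → α), Finset.mul_sum (ι := α)]
          rw [Finset.sum_comm]
          simp only [mul_left_comm]
      _ ≤ ∑ M : Fin s → α, (∏ i, ν (M i)) * (∑ x, ν x * f (Fin.cons x M) + c 0)
            + ∑ i : Fin s, c i.succ := by gcongr with M; exact h0 M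
      _ = _ := by
          simp only [mul_add, Finset.sum_add_distrib, ← Finset.sum_mul, hprod, one_mul, add_assoc,
            Finset.mul_sum (ι := Fin s → α), Finset.mul_sum (ι := α)]
          rw [Finset.sum_comm]
          simp only [mul_left_comm]

/-- The positions in which a deterministic algorithm reads row `i`. -/
def DetAlg.row {n s : ℕ} (T : DetAlg n s) (i : Fin s) : Finset (Fin n) :=
  Finset.univ.filter fun j => (i, j) ∈ T.queries

lemma DetAlg.sum_card_row {n s : ℕ} (T : DetAlg n s) : ∑ i, (T.row i).card = T.queries.card := by
  rw [Finset.card_eq_sum_card_fiberwise (f := Prod.fst) (t := Finset.univ) (by simp)]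
  refine Finset.sum_congr rfl fun i _ => ?_
  refine Finset.card_bij (fun j _ => (i, j)) ?_ ?_ ?_
  · intro j hj; simpa [DetAlg.row] using hj
  · intro j _ j' _ h; simpa using h
  · rintro ⟨i', j⟩ hb
    obtain ⟨hb, rfl⟩ := Finset.mem_filter.1 hb
    exact ⟨j, by simpa [DetAlg.row] using hb, rfl⟩

lemma DetAlg.run_congr {n s : ℕ} (T : DetAlg n s) {M M' : Fin s → BitString n}
    (h : ∀ e ∈ T.queries, M e.1 e.2 = M' e.1 e.2) : T.run M = T.run M' := by
  unfold DetAlg.run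
  congr 1
  funext e
  exact h e.1 e.2

lemma map_run_apply {n s : ℕ} (T : DetAlg n s) (P : PMF (BitString n)) :
    ((sampleMatrix P s).map T.run) true =
      ∑ M, (∏ i, P (M i)) * (if T.run M = true then 1 else 0) := by
  rw [PMF.map_apply, tsum_fintype]
  refine Finset.sum_congr rfl fun M _ => ?_
  rw [mul_ite, mul_one, mul_zero]
  by_cases h : T.run M = true
  · rw [if_pos h.symm, if_pos h]; rfl
  · rw [if_neg (Ne.symm h), if_neg h]

/-- Only the rows with at least two queries in `C ∪ E` help in telling `p` from `0`. -/
lemma map_run_blockDist_le {n h s : ℕ} [NeZero h] (x : Fin h → BitString n)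
    {C E : Finset (Fin n)} (hCE : Disjoint C E) {p : ℝ≥0∞} (hp : p ≤ 1) (T : DetAlg n s) :
    ((sampleMatrix (blockDist x C E 0 zero_le_one) s).map T.run) true ≤
      ((sampleMatrix (blockDist x C E p hp) s).map T.run) true +
        ∑ i, if 2 ≤ (T.row i ∩ (C ∪ E)).card then p else 0 := by
  rw [map_run_apply, map_run_apply]
  refine sum_prod_mul_le _ _ _ _ fun i M => ?_
  split_ifs with hi
  · have hone : ∑ z, blockDist x C E 0 zero_le_one z = 1 := by
      simpa [tsum_fintype] using (blockDist x C E 0 zero_le_one).tsum_coe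
    calc _ ≤ ∑ z, (blockDist x C E p hp z * (if T.run (Function.update M i z) = true then 1 else 0)
            + p * blockDist x C E 0 zero_le_one z) := by
          refine Finset.sum_le_sum fun z _ => ?_
          split_ifs
          · simpa using blockDist_zero_le x C E hp z
          · simp
      _ = _ := by rw [Finset.sum_add_distrib, ← Finset.mul_sum, hone, mul_one]
  · have hF : ∀ z z' : BitString n, (∀ j ∈ T.row i, z j = z' j) →
        (if T.run (Function.update M i z) = true then (1 : ℝ≥0∞) else 0) =
          if T.run (Function.update M i z') = true then 1 else 0 := by
      intro z z' hz
      rw [T.run_congr (M' := Function.update M i z')]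
      rintro ⟨a, j⟩ he
      by_cases ha : a = i
      · subst ha
        simpa using hz j (by simpa [DetAlg.row] using he)
      · simp [ha]
    have h1 : (T.row i ∩ (C ∪ E)).card ≤ 1 := by omega
    rw [sum_blockDist_mul_eq x _ hCE _ h1 _ hF, sum_blockDist_mul_eq x _ hCE _ h1 _ hF, add_zero]

/-- A test must see, in expectation, at least `1 / (3p)` rows with two or more queries in
`C ∪ E`. -/
lemma third_le_of_isTest {n h s m : ℕ} [NeZero h] {x : Fin h → BitString n}
    {C E : Finset (Fin n)} (hCE : Disjoint C E) {p : ℝ≥0∞} (hp : p ≤ 1) {ε : ℝ}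
    (hm : 2 * h ≤ m) (hfar : IsFar ε (blockDist x C E p hp) (boundedSupport n m))
    {𝒜 : NonAdaptiveAlg n s} (h𝒜 : 𝒜.IsTest ε (boundedSupport n m)) :
    1 / 3 ≤ ∑' T, 𝒜 T * ∑ i, if 2 ≤ (DetAlg.row T i ∩ (C ∪ E)).card then p else 0 := by
  have h1 := h𝒜.1 _ (blockDist_zero_mem x C E hm)
  have h2 := h𝒜.2 _ hfar
  have hsum : 𝒜.output (blockDist x C E p hp) true + 𝒜.output (blockDist x C E p hp) false = 1 := by
    simpa [tsum_fintype] using (𝒜.output (blockDist x C E p hp)).tsum_coe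
  have hle : 𝒜.output (blockDist x C E 0 zero_le_one) true ≤
      𝒜.output (blockDist x C E p hp) true +
        ∑' T, 𝒜 T * ∑ i, if 2 ≤ (DetAlg.row T i ∩ (C ∪ E)).card then p else 0 := by
    simp only [NonAdaptiveAlg.output, PMF.bind_apply]
    rw [← ENNReal.tsum_add]
    refine ENNReal.tsum_le_tsum fun T => ?_
    rw [← mul_add]
    gcongr
    exact map_run_blockDist_le x hCE hp T
  set X := ∑' T, 𝒜 T * ∑ i, if 2 ≤ (DetAlg.row T i ∩ (C ∪ E)).card then p else 0
  have h3 : (1 : ℝ≥0∞) + 1 / 3 ≤ 1 + X := by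
    calc (1 : ℝ≥0∞) + 1 / 3 = 2 / 3 + 2 / 3 := by
          nth_rw 1 [← ENNReal.div_self (a := 3) (by simp) (by simp)]
          rw [ENNReal.div_add_div_same, ENNReal.div_add_div_same]
          norm_num
      _ ≤ _ := add_le_add h1.le h2.le
      _ ≤ _ := add_le_add_left hle _
      _ = 1 + X := by rw [add_right_comm, hsum]
  exact (ENNReal.add_le_add_iff_left ENNReal.one_ne_top).1 h3

/-! ### One scale, and the sum over the scales -/

lemma isFar_blockDist {n h m k l : ℕ} [NeZero h] {ε : ℝ} (hε : 0 < ε) {x : Fin h → BitString n}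
    (hx : ∀ t t', t ≠ t' → n ≤ 4 * hammingDist (x t) (x t')) {C E : Finset (Fin n)}
    (hCE : Disjoint C E) (hC : C.card = l) (hE : E.card = l) (hm : m ≤ 2 * h + 1) (hl : 0 < l)
    (hl1 : 64 * 2 ^ k * l ≤ n) (hl2 : n ≤ 128 * 2 ^ k * l)
    (hp2 : 2048 * (2 ^ k * ε) ≤ 1) (hp : ENNReal.ofReal (1024 * (2 ^ k * ε)) ≤ 1) :
    IsFar ε (blockDist x C E (ENNReal.ofReal (1024 * (2 ^ k * ε))) hp) (boundedSupport n m) := by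
  set p := ENNReal.ofReal (1024 * (2 ^ k * ε)) with hpdef
  have hh : 0 < h := Nat.pos_of_ne_zero (NeZero.ne h)
  have hk : 1 ≤ 2 ^ k := Nat.one_le_two_pow
  have hy : ∀ i j : Fin h × Bool × Bool, i ≠ j →
      l ≤ hammingDist (flipOn C E (x i.1) i.2) (flipOn C E (x j.1) j.2) := by
    rintro ⟨t, b⟩ ⟨t', b'⟩ hne
    by_cases ht : t = t'
    · subst ht
      exact le_hammingDist_flipOn hCE hC.ge hE.ge _ fun hb => hne (Prod.ext rfl hb)
    · have h1 := hammingDist_le_hammingDist_flipOn_add C E (x t) (x t') b b'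
      have h2 := hx t t' ht
      have h3 := Finset.card_union_le C E
      have h4 : 64 * l ≤ 64 * 2 ^ k * l := Nat.mul_le_mul_right _ (by omega)
      change l ≤ hammingDist (flipOn C E (x t) b) (flipOn C E (x t') b')
      omega
  have hinj : Function.Injective fun i : Fin h × Bool × Bool => flipOn C E (x i.1) i.2 := by
    intro i j hij
    by_contra hne
    have := hy i j hne
    rw [show flipOn C E (x i.1) i.2 = flipOn C E (x j.1) j.2 from hij, hammingDist_self] at this
    omega
  have hp1 : p ≤ 1 - p := by
    refine ENNReal.le_sub_of_add_le_left ENNReal.ofReal_ne_top ?_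
    rw [hpdef, ← ENNReal.ofReal_add (by positivity) (by positivity), ENNReal.ofReal_le_one]
    linarith
  have key := le_distToProperty (N := h) (m := m) (blockDist x C E p hp) _ hy hl
    (θ := p / (2 * h)) (fun i => by
      rw [blockDist, map_apply_injective _ hinj]; exact le_blockIndex hp hp1 i)
    (by simp; omega)
  refine lt_of_lt_of_le ?_ key
  have hn : 0 < n := lt_of_lt_of_le (by positivity : 0 < 64 * 2 ^ k * l) hl1
  have e : (l / (2 * n) : ℝ≥0∞) * (h * (p / (2 * h))) =
      ENNReal.ofReal (l / (2 * n) * (h * ((1024 * (2 ^ k * ε)) / (2 * h)))) := by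
    rw [ENNReal.ofReal_mul (by positivity), ENNReal.ofReal_mul (by positivity),
      ENNReal.ofReal_div_of_pos (by positivity), ENNReal.ofReal_div_of_pos (by positivity),
      ENNReal.ofReal_mul two_pos.le, ENNReal.ofReal_mul two_pos.le]
    simp [hpdef]
  rw [e]
  refine (ENNReal.ofReal_lt_ofReal_iff_of_nonneg hε.le).2 ?_
  have hn' : (0 : ℝ) < n := by exact_mod_cast hn
  have hh' : (0 : ℝ) < h := by exact_mod_cast hh
  have h2 : (n : ℝ) ≤ 128 * 2 ^ k * l := by exact_mod_cast hl2
  have e2 : (l : ℝ) / (2 * n) * (h * ((1024 * (2 ^ k * ε)) / (2 * h))) =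
      256 * (2 ^ k * l) * ε / n := by field_simp; ring
  rw [e2, lt_div_iff₀ hn']
  nlinarith

/-- The contribution of one scale `k`, where `C ∪ E` is a random set of density at most `2⁻ᵏ`: a
row with `r` queries meets it twice with probability at most `min 1 (r² / 4ᵏ)`. -/
lemma third_le_scale {n h s m k l : ℕ} [NeZero h] {ε : ℝ} (hε : 0 < ε)
    (hh : 2 ^ h ≤ n) (hm1 : 2 * h ≤ m) (hm2 : m ≤ 2 * h + 1) (hl : 0 < l)
    (hl1 : 64 * 2 ^ k * l ≤ n) (hl2 : n ≤ 128 * 2 ^ k * l)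
    (hp2 : 2048 * (2 ^ k * ε) ≤ 1) {𝒜 : NonAdaptiveAlg n s}
    (h𝒜 : 𝒜.IsTest ε (boundedSupport n m)) :
    1 / 3 ≤ ∑' T, 𝒜 T * ∑ i, ENNReal.ofReal
      (1024 * ε * min ((2 : ℝ) ^ k) (((DetAlg.row T i).card : ℝ) ^ 2 / 2 ^ k)) := by
  obtain ⟨x, hx⟩ := exists_code h n hh
  set p := ENNReal.ofReal (1024 * (2 ^ k * ε)) with hpdef
  have hp : p ≤ 1 := ENNReal.ofReal_le_one.2 (by nlinarith [show (0:ℝ) < 2 ^ k * ε by positivity])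
  set 𝓕 : Finset (Finset (Fin n)) := Finset.univ.powersetCard (2 * l)
  have hD : ∀ D ∈ 𝓕, 1 / 3 ≤
      ∑' T, 𝒜 T * ∑ i, if 2 ≤ (DetAlg.row T i ∩ D).card then p else 0 := by
    intro D hD
    have hDc := (Finset.mem_powersetCard.1 hD).2
    obtain ⟨C, hCD, hC⟩ := Finset.exists_subset_card_eq (s := D) (n := l) (by omega)
    have hE : (D \ C).card = l := by rw [Finset.card_sdiff_of_subset hCD]; omega
    have := third_le_of_isTest Finset.disjoint_sdiff hp hm1
      (isFar_blockDist hε hx Finset.disjoint_sdiff hC hE hm2 hl hl1 hl2 hp2 hp) h𝒜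
    rwa [Finset.union_sdiff_of_subset hCD] at this
  have hn : 0 < n := lt_of_lt_of_le (by positivity) hh
  have hk : 1 ≤ 2 ^ k := Nat.one_le_two_pow
  have hc : 𝓕.card = n.choose (2 * l) := by simp [𝓕]
  have hcpos : 0 < 𝓕.card := by
    rw [hc]
    refine Nat.choose_pos (le_trans ?_ hl1)
    exact Nat.mul_le_mul_right _ (by omega)
  have hbad : ∀ R : Finset (Fin n),
      ((𝓕.filter fun D => 2 ≤ (R ∩ D).card).card : ℝ) * (2 ^ k) ≤
        𝓕.card * min ((2 : ℝ) ^ k) ((R.card : ℝ) ^ 2 / 2 ^ k) := by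
    intro R
    rw [mul_min_of_nonneg _ _ (Nat.cast_nonneg _)]
    refine le_min ?_ ?_
    · gcongr
      exact Finset.filter_subset _ _
    · have h1 := card_filter_two_le_inter (d := 2 * l) R
      rw [← hc] at h1
      have h2 : 2 ^ k * (2 * l) ≤ n := by
        refine le_trans ?_ hl1
        nlinarith [Nat.zero_le (2 ^ k * l)]
      have h3 : n ^ 2 * ((𝓕.filter fun D => 2 ≤ (R ∩ D).card).card * 2 ^ k * 2 ^ k) ≤
          n ^ 2 * (𝓕.card * R.card ^ 2) := by
        calc _ = (n ^ 2 * (𝓕.filter fun D => 2 ≤ (R ∩ D).card).card) * (2 ^ k * 2 ^ k) := by ring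
          _ ≤ (R.card ^ 2 * ((2 * l) ^ 2 * 𝓕.card)) * (2 ^ k * 2 ^ k) := Nat.mul_le_mul_right _ h1
          _ = R.card ^ 2 * 𝓕.card * (2 ^ k * (2 * l)) ^ 2 := by ring
          _ ≤ R.card ^ 2 * 𝓕.card * n ^ 2 := by gcongr
          _ = _ := by ring
      have h4 := Nat.le_of_mul_le_mul_left h3 (by positivity)
      rw [← mul_div_assoc, le_div_iff₀ (by positivity)]
      exact_mod_cast h4
  have hsum : (𝓕.card : ℝ≥0∞) * (1 / 3) ≤ 𝓕.card * ∑' T, 𝒜 T * ∑ i, ENNReal.ofReal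
      (1024 * ε * min ((2 : ℝ) ^ k) (((DetAlg.row T i).card : ℝ) ^ 2 / 2 ^ k)) := by
    calc (𝓕.card : ℝ≥0∞) * (1 / 3) = ∑ D ∈ 𝓕, 1 / 3 := by simp
      _ ≤ ∑ D ∈ 𝓕, ∑' T, 𝒜 T * ∑ i, if 2 ≤ (DetAlg.row T i ∩ D).card then p else 0 :=
          Finset.sum_le_sum hD
      _ = ∑' T, 𝒜 T * ∑ i, ((𝓕.filter fun D => 2 ≤ (DetAlg.row T i ∩ D).card).card * p) := by
          rw [← Summable.tsum_finsetSum fun _ _ => ENNReal.summable]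
          refine tsum_congr fun T => ?_
          rw [← Finset.mul_sum, Finset.sum_comm]
          congr 1
          refine Finset.sum_congr rfl fun i _ => ?_
          rw [← Finset.sum_filter, Finset.sum_const, nsmul_eq_mul]
      _ ≤ ∑' T, 𝒜 T * ∑ i, (𝓕.card * ENNReal.ofReal
            (1024 * ε * min ((2 : ℝ) ^ k) (((DetAlg.row T i).card : ℝ) ^ 2 / 2 ^ k))) := by
          refine ENNReal.tsum_le_tsum fun T =>
            mul_le_mul' le_rfl (Finset.sum_le_sum fun i _ => ?_)
          rw [hpdef, ← ENNReal.ofReal_natCast, ← ENNReal.ofReal_natCast,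
            ← ENNReal.ofReal_mul (Nat.cast_nonneg _), ← ENNReal.ofReal_mul (Nat.cast_nonneg _)]
          refine ENNReal.ofReal_le_ofReal ?_
          have := mul_le_mul_of_nonneg_left (hbad (DetAlg.row T i))
            (show 0 ≤ 1024 * ε by positivity)
          linarith
      _ = _ := by
          rw [← ENNReal.tsum_mul_left]
          refine tsum_congr fun T => ?_
          rw [← Finset.mul_sum, mul_left_comm]
  exact (ENNReal.mul_le_mul_iff_right (by exact_mod_cast hcpos.ne') (by finiteness)).1 hsum

/-- A lower bound on the number of queries from the number `K` of scales. -/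
lemma le_queries_of_isTest {n s m q K : ℕ} {ε : ℝ} (hε : 0 < ε) (hm : 2 ≤ m)
    (hn : 2 ^ (m / 2) + 64 * 2 ^ K ≤ n) (hK : ∀ k < K, 2048 * (2 ^ k * ε) ≤ 1)
    {𝒜 : NonAdaptiveAlg n s} (h𝒜 : 𝒜.IsTest ε (boundedSupport n m)) (hq : 𝒜.MakesAtMost q) :
    (K : ℝ) / 3 ≤ 6144 * ε * q := by
  have : NeZero (m / 2) := ⟨by omega⟩
  have hscale : ∀ k ∈ Finset.range K, 1 / 3 ≤ ∑' T, 𝒜 T * ∑ i, ENNReal.ofReal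
      (1024 * ε * min ((2 : ℝ) ^ k) (((DetAlg.row T i).card : ℝ) ^ 2 / 2 ^ k)) := by
    intro k hk
    rw [Finset.mem_range] at hk
    have hkK : 64 * 2 ^ k ≤ 64 * 2 ^ K :=
      Nat.mul_le_mul_left _ (Nat.pow_le_pow_right two_pos hk.le)
    have hpos : 0 < 64 * 2 ^ k := by positivity
    have h2 : 1 ≤ 2 ^ (m / 2) := Nat.one_le_two_pow
    have hl : 0 < n / (64 * 2 ^ k) := Nat.div_pos (by omega) hpos
    refine third_le_scale (h := m / 2) (l := n / (64 * 2 ^ k)) hε (by omega) (by omega) (by omega)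
      hl (Nat.mul_div_le _ _) ?_ (hK k hk) h𝒜
    have := Nat.lt_mul_div_succ n hpos
    nlinarith
  have hall : ENNReal.ofReal ((K : ℝ) / 3) ≤ ENNReal.ofReal (6144 * ε * q) := by
    calc ENNReal.ofReal ((K : ℝ) / 3) = ∑ k ∈ Finset.range K, 1 / 3 := by
          rw [ENNReal.ofReal_div_of_pos (by norm_num)]
          simp [div_eq_mul_inv]
      _ ≤ ∑ k ∈ Finset.range K, ∑' T, 𝒜 T * ∑ i, ENNReal.ofReal
            (1024 * ε * min ((2 : ℝ) ^ k) (((DetAlg.row T i).card : ℝ) ^ 2 / 2 ^ k)) :=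
          Finset.sum_le_sum hscale
      _ = ∑' T, 𝒜 T * ∑ i, ∑ k ∈ Finset.range K, ENNReal.ofReal
            (1024 * ε * min ((2 : ℝ) ^ k) (((DetAlg.row T i).card : ℝ) ^ 2 / 2 ^ k)) := by
          rw [← Summable.tsum_finsetSum fun _ _ => ENNReal.summable]
          refine tsum_congr fun T => ?_
          rw [← Finset.mul_sum, Finset.sum_comm]
      _ ≤ ∑' T, 𝒜 T * ENNReal.ofReal (6144 * ε * q) := by
          refine ENNReal.tsum_le_tsum fun T => ?_
          by_cases hT : 𝒜 T = 0
          · simp [hT]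
          gcongr
          calc _ = ∑ i, ENNReal.ofReal (1024 * ε * ∑ k ∈ Finset.range K,
                  min ((2 : ℝ) ^ k) (((DetAlg.row T i).card : ℝ) ^ 2 / 2 ^ k)) := by
                refine Finset.sum_congr rfl fun i _ => ?_
                rw [← ENNReal.ofReal_sum_of_nonneg fun _ _ => by positivity, Finset.mul_sum]
            _ ≤ ∑ i, ENNReal.ofReal (1024 * ε * (6 * (DetAlg.row T i).card)) := by
                gcongr with i
                exact sum_min_two_pow_le _ (Nat.cast_nonneg _) K
            _ = ENNReal.ofReal (6144 * ε * T.queries.card) := by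
                rw [← ENNReal.ofReal_sum_of_nonneg fun _ _ => by positivity, ← T.sum_card_row,
                  Nat.cast_sum, Finset.mul_sum]
                congr 1
                exact Finset.sum_congr rfl fun i _ => by ring
            _ ≤ _ := by
                gcongr
                exact hq T hT
      _ = _ := by rw [ENNReal.tsum_mul_right, 𝒜.tsum_coe, one_mul]
  exact (ENNReal.ofReal_le_ofReal_iff (by positivity)).1 hall

end HugeObject

/-! ### The choice of the scales -/

theorem mainTheorem1 :
    ∃ c : ℝ, 0 < c ∧ ∃ ε₀ : ℝ, 0 < ε₀ ∧ ε₀ < 1 ∧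
      ∀ m : ℕ, 2 ≤ m → ∀ ε : ℝ, 0 < ε → ε < ε₀ →
        ∃ N : ℕ, ∀ n : ℕ, N ≤ n → ∀ (s q : ℕ) (𝒜 : HugeObject.NonAdaptiveAlg n s),
          𝒜.IsTest ε (HugeObject.boundedSupport n m) → 𝒜.MakesAtMost q →
            c * (ε⁻¹ * Real.log ε⁻¹) ≤ (q : ℝ) := by
  refine ⟨1 / 73728, by norm_num, 1 / 2 ^ 22, by norm_num, by norm_num, fun m hm ε hε hε0 => ?_⟩
  -- With about `(log ε⁻¹) / 2` scales, `2 ^ k ≤ ε ^ (-1/2)` at each of them.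
  set L := Real.log ε⁻¹ with hL
  set K := ⌊L / 2⌋₊
  have hexp : Real.exp L = ε⁻¹ := Real.exp_log (inv_pos.2 hε)
  have hL4 : 4 ≤ L := by
    have h1 : Real.log (2 ^ 22) ≤ L := by
      refine Real.log_le_log (by norm_num) ?_
      rw [le_inv_comm₀ (by norm_num) hε]
      simpa using hε0.le
    rw [Real.log_pow] at h1
    push_cast at h1
    linarith [Real.log_two_gt_d9]
  have hKle : (K : ℝ) ≤ L / 2 := Nat.floor_le (by linarith)
  have hKge : L / 4 ≤ K := by linarith [Nat.lt_floor_add_one (L / 2)]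
  have hK : ∀ k < K, 2048 * (2 ^ k * ε) ≤ 1 := by
    intro k hk
    have h2 : (2 : ℝ) ^ k ≤ Real.exp k := by
      rw [← Real.exp_one_pow]
      have := Real.add_one_le_exp 1
      exact pow_le_pow_left₀ two_pos.le (by linarith) _
    have hkK : (k : ℝ) ≤ K := by exact_mod_cast hk.le
    have h3 : ((2 : ℝ) ^ k) ^ 2 * ε ≤ 1 := by
      calc ((2 : ℝ) ^ k) ^ 2 * ε ≤ (Real.exp k) ^ 2 * ε := by gcongr
        _ = Real.exp (2 * k) * ε := by rw [← Real.exp_nat_mul]; norm_num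
        _ ≤ Real.exp L * ε := by gcongr; linarith
        _ = 1 := by rw [hexp, inv_mul_cancel₀ hε.ne']
    have h4 : 2 ^ 22 * ε ≤ 1 := by
      have := (lt_div_iff₀ (by norm_num : (0 : ℝ) < 2 ^ 22)).1 hε0
      linarith
    refine le_of_sq_le_sq ?_ zero_le_one
    calc (2048 * (2 ^ k * ε)) ^ 2 = (2 ^ 22 * ε) * (((2 : ℝ) ^ k) ^ 2 * ε) := by ring
      _ ≤ 1 * 1 := by gcongr
      _ = 1 ^ 2 := by norm_num
  refine ⟨2 ^ (m / 2) + 64 * 2 ^ K, fun n hn s q 𝒜 h𝒜 hq => ?_⟩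
  have key := HugeObject.le_queries_of_isTest hε hm hn hK h𝒜 hq
  have h5 : L ≤ 73728 * (ε * q) := by linarith
  calc 1 / 73728 * (ε⁻¹ * L) ≤ 1 / 73728 * (ε⁻¹ * (73728 * (ε * q))) := by gcongr
    _ = q := by field_simp
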